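/- A bilinear algorithm of rank $R$ is a triple $(\mathbf A,\mathbf B,\mathbf C)$ of complex matrices with $R$ columns each; on inputs $x,y$ it computes $\mathbf C\,[(\mathbf A^{T}x)\odot(\mathbf B^{T}y)]$, where $\odot$ is the entrywise product. For $1\le k\le R$ let $\mathcal P_R^{(k)}$ be the set of matrices formed by $k$ different columns of the $R\times R$ identity matrix. A function $\mathcal E$ from triples of natural numbers to $\mathbb R$ is an expansion bound for $(\mathbf A,\mathbf B,\mathbf C)$ if it is non-decreasing in each variable and, for all $k\in\{1,\dots,R\}$ and all $\mathbf P\in\mathcal P_R^{(k)}$, $$k\le \mathcal E\big(\operatorname{rank}(\mathbf{AP}),\operatorname{rank}(\mathbf{BP}),\operatorname{rank}(\mathbf{CP})\big).$$ Let $(\mathbf A,\mathbf B,\mathbf C)$ be Strassen's base algorithm for the multiplication of $2\times 2$ matrices, a bilinear algorithm of rank $7$, given (with the entries of $2\times2$ matrices listed row by row) by $$\mathbf{A} = \begin{bmatrix} 1&0&1&0&1&-1&0\\ 0&0&0&0&1&0&1\\ 0&1&0&0&0&1&0\\ 1&1&0&1&0&0&-1 \end{bmatrix},\quad \mathbf{B}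 = \begin{bmatrix} 1&1&0&-1&0&1&0\\ 0&0&1&0&0&1&0\\ 0&0&0&1&0&0&1\\ 1&0&-1&0&1&0&1 \end{bmatrix},\quad \mathbf{C} = \begin{bmatrix} 1&0&0&1&-1&0&1\\ 0&0&1&0&1&0&0\\ 0&1&0&1&0&0&0\\ 1&-1&1&0&0&1&0 \end{bmatrix}.$$ Then for every integer $\tau\ge 1$ the function $$\mathcal E(r_A,r_B,r_C)=\min(r_A,r_B,r_C)^{\log_2 3}$$ is an expansion bound for the $\tau$-fold nested bilinear algorithm $\big(\mathbf A^{\otimes\tau},\mathbf B^{\otimes\tau},\mathbf C^{\otimes\tau}\big)$, which has rank $7^\tau$ and where $\otimes$ is the Kronecker product. -/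

import Mathlib

open scoped Matrix

/-- A bilinear algorithm: two encoding matrices `A`, `B` and a decoding matrix `C` with the same
set `R` of columns. The rank of the algorithm is the number of elements of `R`. -/
structure BilinearAlgorithm (mA mB mC R : Type) where
  A : Matrix mA R ℂ
  B : Matrix mB R ℂ
  C : Matrix mC R ℂ

namespace BilinearAlgorithm

/-- The output `C [(Aᵀ x) ⊙ (Bᵀ y)]` of a bilinear algorithm on the inputs `x` and `y`. -/
def eval {mA mB mC R : Type} [Fintype mA] [Fintype mB] [Fintype R]
    (alg : BilinearAlgorithm mA mB mC R) (x : mA → ℂ) (y : mB → ℂ) : mC → ℂ :=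
  alg.C *ᵥ ((alg.Aᵀ *ᵥ x) * (alg.Bᵀ *ᵥ y))

end BilinearAlgorithm

/-- The Kronecker product of `τ` matrices. Its rows are indexed by the tuples of row indices and
its columns by the tuples of column indices; the entry at `(f, g)` is `∏ i, M i (f i) (g i)`. -/
def kroneckerProd {τ : ℕ} {m n : Fin τ → Type} (M : ∀ i, Matrix (m i) (n i) ℂ) :
    Matrix (∀ i, m i) (∀ i, n i) ℂ :=
  Matrix.of fun f g => ∏ i, M i (f i) (g i)

/-- The nested bilinear algorithm of a finite sequence of bilinear algorithms. -/
def BilinearAlgorithm.nested {τ : ℕ} {mA mB mC R : Fin τ → Type}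
    (alg : ∀ i, BilinearAlgorithm (mA i) (mB i) (mC i) (R i)) :
    BilinearAlgorithm (∀ i, mA i) (∀ i, mB i) (∀ i, mC i) (∀ i, R i) where
  A := kroneckerProd fun i => (alg i).A
  B := kroneckerProd fun i => (alg i).B
  C := kroneckerProd fun i => (alg i).C

/-- The set of matrices formed by `k` different columns of the identity matrix. -/
def columnSelections (R : Type) [DecidableEq R] (k : ℕ) : Set (Matrix R (Fin k) ℂ) :=
  {P | ∃ s : Fin k ↪ R, P = (1 : Matrix R R ℂ).submatrix id s}

/-- `E` is an expansion bound for the bilinear algorithm `alg`: it is non-decreasing in each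
variable, and every nonempty set of columns has at most
`E (rank (A P)) (rank (B P)) (rank (C P))` elements, where `P` selects these columns. -/
structure BilinearAlgorithm.IsExpansionBound {mA mB mC R : Type} [Fintype R] [DecidableEq R]
    (alg : BilinearAlgorithm mA mB mC R) (E : ℕ → ℕ → ℕ → ℝ) : Prop where
  mono : ∀ ⦃a a' b b' c c' : ℕ⦄, a ≤ a' → b ≤ b' → c ≤ c' → E a b c ≤ E a' b' c'
  bound : ∀ k : ℕ, 1 ≤ k → k ≤ Fintype.card R → ∀ P ∈ columnSelections R k,
    (k : ℝ) ≤ E (alg.A * P).rank (alg.B * P).rank (alg.C * P).rank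

/-- Strassen's base algorithm for the product of two `2 × 2` matrices, whose entries are listed
row by row. -/
def strassen : BilinearAlgorithm (Fin 4) (Fin 4) (Fin 4) (Fin 7) where
  A := !![1, 0, 1, 0, 1, -1, 0;
          0, 0, 0, 0, 1, 0, 1;
          0, 1, 0, 0, 0, 1, 0;
          1, 1, 0, 1, 0, 0, -1]
  B := !![1, 1, 0, -1, 0, 1, 0;
          0, 0, 1, 0, 0, 1, 0;
          0, 0, 0, 1, 0, 0, 1;
          1, 0, -1, 0, 1, 0, 1]
  C := !![1, 0, 0, 1, -1, 0, 1;
          0, 0, 1, 0, 1, 0, 0;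
          0, 1, 0, 1, 0, 0, 0;
          1, -1, 1, 0, 0, 1, 0]

/-- The triple above does compute the product of two `2 × 2` matrices. -/
theorem strassen_eval (X Y : Matrix (Fin 2) (Fin 2) ℂ) :
    strassen.eval ![X 0 0, X 0 1, X 1 0, X 1 1] ![Y 0 0, Y 0 1, Y 1 0, Y 1 1] =
      ![(X * Y) 0 0, (X * Y) 0 1, (X * Y) 1 0, (X * Y) 1 1] := by
  ext i
  fin_cases i <;>
    simp [BilinearAlgorithm.eval, strassen, Matrix.mulVec, dotProduct, Fin.sum_univ_succ,
      Matrix.mul_apply, Matrix.transpose_apply] <;>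
    ring

/-! Write p = log₂ 3. It suffices to find, in every set S of columns of a Kronecker power, an
independent subset I with |S| ≤ |I|^p (`exists_linearIndepOn_kroneckerProd`). Induct on the number
of factors: slice S by its first index e, take an independent I_e in each slice, and weight column e
of the base matrix by |I_e|. `HasDominatingBases` supplies a basis c of base columns; the tensors of
c_j with I_{c_j} are independent, and the power sum over all seven slices is at most the p-th power
of their number. The dominating basis is a spanning tree of large weight: each of the three omitted
edges is absorbed by one use of s^p + a^p + t^p ≤ (s + a)^p, valid for t ≤ s, a. -/

/-- Convexity of `x ↦ x ^ log₂ 3`, normalised at `2 ^ log₂ 3 = 3`. -/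
theorem rpow_add_rpow_add_rpow_le {s a t : ℝ} (ht : 0 ≤ t) (hs : t ≤ s) (ha : t ≤ a) :
    s ^ Real.logb 2 3 + a ^ Real.logb 2 3 + t ^ Real.logb 2 3 ≤ (s + a) ^ Real.logb 2 3 := by
  have hp : 1 ≤ Real.logb 2 3 := by
    rw [Real.le_logb_iff_rpow_le (by norm_num) (by norm_num)]
    norm_num
  have h2 : (2 : ℝ) ^ Real.logb 2 3 = 3 :=
    Real.rpow_logb (by norm_num) (by norm_num) (by norm_num)
  have hconv := convexOn_rpow hp
  -- Increments of a convex function grow: `x + d` and `y` are complementary convex combinations of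
  -- `x` and `y + d`.
  have key : ∀ {x y d : ℝ}, 0 ≤ x → x ≤ y → 0 ≤ d →
      (x + d) ^ Real.logb 2 3 + y ^ Real.logb 2 3 ≤
        x ^ Real.logb 2 3 + (y + d) ^ Real.logb 2 3 := by
    intro x y d hx hxy hd
    rcases hd.eq_or_lt with rfl | hd
    · simp
    have hpos : 0 < y + d - x := by linarith
    have e1 : (y - x) / (y + d - x) + d / (y + d - x) = 1 := by field_simp; ring
    have e2 : d / (y + d - x) + (y - x) / (y + d - x) = 1 := by rw [add_comm]; exact e1
    have n1 : 0 ≤ (y - x) / (y + d - x) := div_nonneg (by linarith) hpos.le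
    have n2 : 0 ≤ d / (y + d - x) := div_nonneg hd.le hpos.le
    have hyd : y + d ∈ Set.Ici (0 : ℝ) := by simp only [Set.mem_Ici]; linarith
    have c1 := hconv.2 (Set.mem_Ici.2 hx) hyd n1 n2 e1
    have c2 := hconv.2 (Set.mem_Ici.2 hx) hyd n2 n1 e2
    simp only [smul_eq_mul] at c1 c2
    have r1 : (y - x) / (y + d - x) * x + d / (y + d - x) * (y + d) = x + d := by
      field_simp; ring
    have r2 : d / (y + d - x) * x + (y - x) / (y + d - x) * (y + d) = y := by
      field_simp; ring
    rw [r1] at c1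
    rw [r2] at c2
    generalize (y - x) / (y + d - x) = α at *
    generalize d / (y + d - x) = β at *
    have e3 : β = 1 - α := by linarith
    subst e3
    linarith
  have h1 := key ht hs ht
  have h3 := key (x := t) (y := a) (d := s) ht ha (ht.trans hs)
  have h4 : (t + t) ^ Real.logb 2 3 = 3 * t ^ Real.logb 2 3 := by
    rw [← two_mul, Real.mul_rpow (by norm_num) ht, h2]
  rw [add_comm a s, add_comm t s] at h3
  linarith

/-- Every weighting of the columns of `M` is dominated, in the sense of the exponent `log₂ 3`, by
the weight of four linearly independent columns. -/
def HasDominatingBases (M : Matrix (Fin 4) (Fin 7) ℂ) : Prop :=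
  ∀ r : Fin 7 → ℕ, ∃ c : Fin 4 → Fin 7, LinearIndependent ℂ (fun j => M.col (c j)) ∧
    ∑ e, (r e : ℝ) ^ Real.logb 2 3 ≤ ((∑ j, r (c j) : ℕ) : ℝ) ^ Real.logb 2 3

theorem linearIndependent_col_of_det_ne_zero (N : Matrix (Fin 4) (Fin 7) ℤ) (c : Fin 4 → Fin 7)
    (h : (N.submatrix id c).det ≠ 0) :
    LinearIndependent ℂ (fun j => (N.map (Int.cast : ℤ → ℂ)).col (c j)) := by
  have h1 : (((N.submatrix id c).map (Int.cast : ℤ → ℂ))).det ≠ 0 := by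
    have := (Int.castRingHom ℂ).map_det (N.submatrix id c)
    rw [show (N.submatrix id c).map (Int.cast : ℤ → ℂ)
      = (Int.castRingHom ℂ).mapMatrix (N.submatrix id c) from rfl, ← this]
    simpa using h
  exact Matrix.linearIndependent_cols_of_det_ne_zero h1

/-- The columns of `N` form three triangles `{0, p i true, p i false}` with the common edge `0`;
the spanning trees of this graph give the dominating bases. -/
theorem hasDominatingBases_of_triangles (N : Matrix (Fin 4) (Fin 7) ℤ) (p : Fin 3 → Bool → Fin 7)
    (hsum : ∀ f : Fin 7 → ℝ, ∑ e, f e = f 0 + ∑ i, (f (p i true) + f (p i false)))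
    (h₁ : ∀ x y z, (N.submatrix id ![0, p 0 x, p 1 y, p 2 z]).det ≠ 0)
    (h₂ : ∀ i x y z, (N.submatrix id ![p i x, p i !x, p (i + 1) y, p (i + 2) z]).det ≠ 0) :
    HasDominatingBases (N.map (Int.cast : ℤ → ℂ)) := by
  intro r
  have hσ : ∀ i, ∃ x, r (p i !x) ≤ r (p i x) := fun i => by
    rcases le_total (r (p i true)) (r (p i false)) with h | h
    · exact ⟨false, h⟩
    · exact ⟨true, h⟩
  choose σ hσ using hσ
  have hsum' : ∀ f : Fin 7 → ℝ, ∑ e, f e = f 0 + ∑ i, (f (p i (σ i)) + f (p i !(σ i))) := by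
    intro f
    rw [hsum]
    congr 1
    refine Finset.sum_congr rfl fun i _ => ?_
    cases σ i
    · exact add_comm _ _
    · rfl
  have hσ' : ∀ i, (r (p i !(σ i)) : ℝ) ≤ r (p i (σ i)) := fun i => Nat.cast_le.2 (hσ i)
  have hpos : ∀ e, (0 : ℝ) ≤ r e := fun e => Nat.cast_nonneg _
  -- If edge 0 is no lighter than the lighter edge of each triangle, the tree keeps 0 and omits
  -- those three edges. The kept weight so far plays `s`, and the next triangle contributes its
  -- heavier edge `a` and lighter edge `t`.
  by_cases h0 : ∀ i, r (p i !(σ i)) ≤ r 0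
  · have h0' : ∀ i, (r (p i !(σ i)) : ℝ) ≤ r 0 := fun i => Nat.cast_le.2 (h0 i)
    refine ⟨_, linearIndependent_col_of_det_ne_zero N _ (h₁ (σ 0) (σ 1) (σ 2)), ?_⟩
    rw [hsum', Fin.sum_univ_three, Fin.sum_univ_four]
    have k1 := rpow_add_rpow_add_rpow_le (hpos _) (h0' 0) (hσ' 0)
    have k2 := rpow_add_rpow_add_rpow_le (hpos _)
      ((h0' 1).trans (le_add_of_nonneg_right (hpos (p 0 (σ 0))))) (hσ' 1)
    have k3 := rpow_add_rpow_add_rpow_le (hpos _)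
      (((h0' 2).trans (le_add_of_nonneg_right (hpos (p 0 (σ 0))))).trans
        (le_add_of_nonneg_right (hpos (p 1 (σ 1))))) (hσ' 2)
    simp
    linarith
  -- Otherwise the tree omits 0 and keeps both edges of the triangle whose lighter edge is heaviest.
  -- That edge bounds every omitted one, so 0 is absorbed first, then the other two lighter edges.
  · obtain ⟨i, hi⟩ := Finite.exists_max fun i => r (p i !(σ i))
    have hi' : ∀ j, (r (p j !(σ j)) : ℝ) ≤ r (p i !(σ i)) := fun j => Nat.cast_le.2 (hi j)
    push Not at h0
    obtain ⟨j, hj⟩ := h0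
    have hr : (r 0 : ℝ) ≤ r (p i !(σ i)) := Nat.cast_le.2 (hj.le.trans (hi j))
    refine ⟨_, linearIndependent_col_of_det_ne_zero N _ (h₂ i (σ i) (σ (i + 1)) (σ (i + 2))), ?_⟩
    have hcyc : ∀ f : Fin 3 → ℝ, ∑ j, f j = f i + f (i + 1) + f (i + 2) := by
      intro f
      rw [Fin.sum_univ_three]
      fin_cases i
      · rfl
      · change _ = f 1 + f 2 + f 0
        ring
      · change _ = f 2 + f 0 + f 1
        ring
    rw [hsum', hcyc, Fin.sum_univ_four]
    have k1 := rpow_add_rpow_add_rpow_le (hpos 0) (hr.trans (hσ' i)) hr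
    have k2 := rpow_add_rpow_add_rpow_le (hpos _)
      ((hi' (i + 1)).trans (le_add_of_nonneg_left (hpos (p i (σ i))))) (hσ' (i + 1))
    have k3 := rpow_add_rpow_add_rpow_le (hpos _)
      (((hi' (i + 2)).trans (le_add_of_nonneg_left (hpos (p i (σ i))))).trans
        (le_add_of_nonneg_right (hpos (p (i + 1) (σ (i + 1)))))) (hσ' (i + 2))
    simp
    linarith

/-- In each of the three matrices, column 0 is, up to signs, the sum of the two columns of each
listed pair, which gives the triangles. -/
theorem hasDominatingBases_strassen_A : HasDominatingBases strassen.A := by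
  have h := hasDominatingBases_of_triangles
    !![1, 0, 1, 0, 1, -1, 0;
       0, 0, 0, 0, 1, 0, 1;
       0, 1, 0, 0, 0, 1, 0;
       1, 1, 0, 1, 0, 0, -1]
    ![fun x => cond x 2 3, fun x => cond x 4 6, fun x => cond x 1 5]
    (fun f => by simp [Fin.sum_univ_succ]; ring) (by decide +kernel) (by decide +kernel)
  convert h using 1
  ext i j
  fin_cases i <;> fin_cases j <;> simp [strassen]

theorem hasDominatingBases_strassen_B : HasDominatingBases strassen.B := by
  have h := hasDominatingBases_of_triangles
    !![1, 1, 0, -1, 0, 1, 0;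
       0, 0, 1, 0, 0, 1, 0;
       0, 0, 0, 1, 0, 0, 1;
       1, 0, -1, 0, 1, 0, 1]
    ![fun x => cond x 1 4, fun x => cond x 5 2, fun x => cond x 6 3]
    (fun f => by simp [Fin.sum_univ_succ]; ring) (by decide +kernel) (by decide +kernel)
  convert h using 1
  ext i j
  fin_cases i <;> fin_cases j <;> simp [strassen]

theorem hasDominatingBases_strassen_C : HasDominatingBases strassen.C := by
  have h := hasDominatingBases_of_triangles
    !![1, 0, 0, 1, -1, 0, 1;
       0, 0, 1, 0, 1, 0, 0;
       0, 1, 0, 1, 0, 0, 0;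
       1, -1, 1, 0, 0, 1, 0]
    ![fun x => cond x 5 6, fun x => cond x 3 1, fun x => cond x 2 4]
    (fun f => by simp [Fin.sum_univ_succ]; ring) (by decide +kernel) (by decide +kernel)
  convert h using 1
  ext i j
  fin_cases i <;> fin_cases j <;> simp [strassen]

/-- The columns `v ⊗ w` with `v` from a linearly independent family and `w` from a linearly
independent set that may depend on `v` are linearly independent. -/
theorem linearIndepOn_kroneckerProd_cons {n : ℕ} (M : Matrix (Fin 4) (Fin 7) ℂ)
    (c : Fin 4 → Fin 7) (hc : LinearIndependent ℂ (fun j => M.col (c j)))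
    (I : Fin 7 → Finset (Fin n → Fin 7))
    (hI : ∀ e, LinearIndepOn ℂ (kroneckerProd fun _ : Fin n => M).col (I e : Set (Fin n → Fin 7)))
    (ι : (Σ _ : Fin 4, Fin n → Fin 7) ↪ (Fin (n + 1) → Fin 7))
    (hι : ∀ x, ι x = Fin.cons (c x.1) x.2) :
    LinearIndepOn ℂ (kroneckerProd fun _ : Fin (n + 1) => M).col
      ((((Finset.univ : Finset (Fin 4)).sigma fun j => I (c j)).map ι :
        Finset (Fin (n + 1) → Fin 7)) : Set (Fin (n + 1) → Fin 7)) := by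
  rw [linearIndepOn_finset_iff]
  intro f hf
  rw [Finset.sum_map, Finset.sum_sigma] at hf
  have hcol : ∀ (i : Fin 4) (g : Fin n → Fin 4) (j : Fin 4) (w : Fin n → Fin 7),
      (kroneckerProd fun _ : Fin (n + 1) => M).col (ι ⟨j, w⟩) (Fin.cons i g) =
        M.col (c j) i * (kroneckerProd fun _ : Fin n => M).col w g := by
    intro i g j w
    rw [hι]
    simp [kroneckerProd, Matrix.col, Fin.prod_univ_succ]
  -- Fixing the row index `g` of the last `n` factors leaves a relation among the columns `c j`
  -- alone, so each coefficient vanishes.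
  have hz : ∀ (g : Fin n → Fin 4) (j : Fin 4),
      ∑ w ∈ I (c j), f (ι ⟨j, w⟩) * (kroneckerProd fun _ : Fin n => M).col w g = 0 := by
    intro g
    refine Fintype.linearIndependent_iff.1 hc _ ?_
    ext i
    have := congrFun hf (Fin.cons i g)
    simp only [Finset.sum_apply, Pi.smul_apply, smul_eq_mul, hcol, Pi.zero_apply] at this ⊢
    rw [← this]
    refine Finset.sum_congr rfl fun j _ => ?_
    rw [Finset.sum_mul]
    exact Finset.sum_congr rfl fun w _ => by ring
  intro x hx
  obtain ⟨⟨j, w⟩, hjw, rfl⟩ := Finset.mem_map.1 hx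
  have hw : w ∈ I (c j) := (Finset.mem_sigma.1 hjw).2
  refine linearIndepOn_finset_iff.1 (hI (c j)) (fun w => f (ι ⟨j, w⟩)) ?_ w hw
  ext g
  simpa only [Finset.sum_apply, Pi.smul_apply, smul_eq_mul, Pi.zero_apply] using hz g j

theorem exists_linearIndepOn_kroneckerProd {M : Matrix (Fin 4) (Fin 7) ℂ}
    (hM : HasDominatingBases M) (n : ℕ) (S : Finset (Fin n → Fin 7)) :
    ∃ I ⊆ S, LinearIndepOn ℂ (kroneckerProd fun _ : Fin n => M).col (I : Set (Fin n → Fin 7)) ∧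
      (S.card : ℝ) ≤ (I.card : ℝ) ^ Real.logb 2 3 := by
  have hlog : Real.logb 2 3 ≠ 0 :=
    (Real.logb_pos (by norm_num) (by norm_num)).ne'
  induction n with
  | zero =>
    refine ⟨S, Finset.Subset.refl _, ?_, ?_⟩
    · rw [linearIndepOn_finset_iff]
      intro f hf x hx
      have hS : S = {x} := Finset.eq_singleton_iff_unique_mem.2
        ⟨hx, fun y _ => Subsingleton.elim _ _⟩
      subst hS
      have := congrFun hf (fun i => i.elim0)
      simpa [kroneckerProd, Matrix.col] using this
    -- The empty set needs `0 ^ p = 0`, hence `p ≠ 0`.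
    · have : S.card ≤ 1 := Finset.card_le_one.2 fun _ _ _ _ => Subsingleton.elim _ _
      interval_cases S.card
      · simp [Real.zero_rpow hlog]
      · simp
  | succ n ih =>
    have ih' := fun e : Fin 7 => ih (Finset.univ.filter fun g => (Fin.cons e g : Fin (n + 1) → Fin 7) ∈ S)
    choose I hIS hI hcard using ih'
    obtain ⟨c, hc, hle⟩ := hM fun e => (I e).card
    have hcinj : Function.Injective c := fun i j hij => hc.injective (by simp only [hij])
    let ι : (Σ _ : Fin 4, Fin n → Fin 7) ↪ (Fin (n + 1) → Fin 7) :=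
      ⟨fun x => Fin.cons (c x.1) x.2, by
        rintro ⟨i, g⟩ ⟨j, h⟩ hx
        obtain ⟨h1, h2⟩ := Fin.cons_injective2 hx
        obtain rfl := hcinj h1
        obtain rfl := h2
        rfl⟩
    refine ⟨(Finset.univ.sigma fun j => I (c j)).map ι, ?_,
      linearIndepOn_kroneckerProd_cons M c hc I hI ι fun _ => rfl, ?_⟩
    · intro x hx
      obtain ⟨⟨j, w⟩, hjw, rfl⟩ := Finset.mem_map.1 hx
      exact (Finset.mem_filter.1 (hIS _ (Finset.mem_sigma.1 hjw).2)).2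
    · rw [Finset.card_map, Finset.card_sigma]
      refine le_trans ?_ hle
      have hS : S.card = ∑ e : Fin 7,
          (Finset.univ.filter fun g => (Fin.cons e g : Fin (n + 1) → Fin 7) ∈ S).card := by
        rw [← Finset.card_sigma]
        refine Finset.card_bij' (fun x _ => ⟨x 0, Fin.tail x⟩) (fun y _ => Fin.cons y.1 y.2)
          ?_ ?_ ?_ ?_
        · intro x hx
          simpa using hx
        · intro y hy
          simpa using hy
        · intro x _
          exact Fin.cons_self_tail x
        · intro y _
          simp
      rw [hS, Nat.cast_sum]
      exact Finset.sum_le_sum fun e _ => hcard e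

theorem card_le_rank_mul_columnSelection {M : Matrix (Fin 4) (Fin 7) ℂ}
    (hM : HasDominatingBases M) {n k : ℕ} {P : Matrix (Fin n → Fin 7) (Fin k) ℂ}
    (hP : P ∈ columnSelections (Fin n → Fin 7) k) :
    (k : ℝ) ≤ (((kroneckerProd fun _ : Fin n => M) * P).rank : ℝ) ^ Real.logb 2 3 := by
  obtain ⟨s, rfl⟩ := hP
  obtain ⟨I, hIS, hI, hcard⟩ :=
    exists_linearIndepOn_kroneckerProd hM n (Finset.univ.map s)
  rw [Finset.card_map, Finset.card_univ, Fintype.card_fin] at hcard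
  refine hcard.trans (Real.rpow_le_rpow (Nat.cast_nonneg _) (Nat.cast_le.2 ?_)
    (Real.logb_nonneg (by norm_num) (by norm_num)))
  rw [show (kroneckerProd fun _ : Fin n => M) * (1 : Matrix (Fin n → Fin 7) _ ℂ).submatrix id s
      = (kroneckerProd fun _ : Fin n => M).submatrix id s from by
    ext i j
    simp [Matrix.mul_apply, Matrix.one_apply]]
  rw [Matrix.rank_eq_finrank_span_cols]
  have h1 := finrank_span_eq_card (R := ℂ) hI.linearIndependent
  replace h1 := h1.trans (Fintype.card_coe I)
  rw [← h1]
  refine Submodule.finrank_mono (Submodule.span_mono ?_)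
  rintro _ ⟨⟨x, hx⟩, rfl⟩
  obtain ⟨j, -, rfl⟩ := Finset.mem_map.1 (hIS hx)
  exact ⟨j, rfl⟩

theorem mainTheorem7 (τ : ℕ) (hτ : 1 ≤ τ) :
    (BilinearAlgorithm.nested (fun _ : Fin τ => strassen)).IsExpansionBound
      (fun rA rB rC => ((min rA (min rB rC) : ℕ) : ℝ) ^ Real.logb 2 3) := by
  refine ⟨fun a a' b b' c c' ha hb hc => ?_, fun k _ _ P hP => ?_⟩
  · exact Real.rpow_le_rpow (Nat.cast_nonneg _)
      (Nat.cast_le.2 (min_le_min ha (min_le_min hb hc)))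
      (Real.logb_nonneg (by norm_num) (by norm_num))
  · have hA := card_le_rank_mul_columnSelection hasDominatingBases_strassen_A hP
    have hB := card_le_rank_mul_columnSelection hasDominatingBases_strassen_B hP
    have hC := card_le_rank_mul_columnSelection hasDominatingBases_strassen_C hP
    have hmin : ∀ a b c : ℕ, (k : ℝ) ≤ (a : ℝ) ^ Real.logb 2 3 →
        (k : ℝ) ≤ (b : ℝ) ^ Real.logb 2 3 → (k : ℝ) ≤ (c : ℝ) ^ Real.logb 2 3 →
        (k : ℝ) ≤ ((min a (min b c) : ℕ) : ℝ) ^ Real.logb 2 3 := by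
      intro a b c ha hb hc
      rcases min_choice a (min b c) with h | h <;> rw [h]
      · exact ha
      · rcases min_choice b c with h | h <;> rw [h] <;> assumption
    exact hmin _ _ _ hA hB hC
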